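/- **Theorem 2.8 (Trek separation for directed graphical models).** Let $G$ be a finite directed acyclic graph with vertex set $V$ and edge set $E$. For parameters $\lambda = (\lambda_{ij})_{i\to j\in E}\in\mathbb{R}^E$ and $\phi=(\phi_i)_{i\in V}\in(0,\infty)^V$, let $\varepsilon_i\sim\mathcal N(0,\phi_i)$, $i \in V$, be independent, let $X$ be the random vector defined recursively by $$X_j=\sum_{i\,:\,i\to j\in E}\lambda_{ij}X_i+\varepsilon_j\qquad(j\in V),$$ and let $\Sigma=\Sigma(\lambda,\phi)$ be the covariance matrix of $X$. The matrices arising in this way are the covariance matrices consistent with $G$. For $A,B\subseteq V$, let $\Sigma_{A,B}=(\sigma_{ab})_{a\in A,\,b\in B}$. A trek from $i$ to $j$ is an ordered pair $(P_1,P_2)$ of directed paths in $G$ (possibly with no edges) that have a common source, where $P_1$ has sink $i$ and $P_2$ has sink $j$. For $C_A,C_B\subseteq V$, the pair $(C_A,C_B)$ $t$-separates $A$ from $B$ if for every trek $(P_1,P_2)$ from a vertex in $A$ to a vertex in $B$, either $P_1$ contains a vertex in $C_A$ or $P_2$ contains a vertex in $C_B$. The sets $A,B,C_A,C_B$ need not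 be disjoint. For all $A,B\subseteq V$ and every integer $r\ge 0$, the submatrix $\Sigma_{A,B}$ has rank less than or equal to $r$ for all covariance matrices $\Sigma$ consistent with $G$ if and only if there exist $C_A,C_B\subseteq V$ with $\#C_A+\#C_B\le r$ such that $(C_A,C_B)$ $t$-separates $A$ from $B$. Consequently, $$\operatorname{rk}(\Sigma_{A,B})\le\min\{\#C_A+\#C_B : (C_A,C_B)\ t\text{-separates } A \text{ from } B\}$$ for all $\Sigma$ consistent with $G$, and equality holds for generic $\Sigma$: it holds for all $(\lambda,\phi)$ in some dense open subset of the parameter space $\mathbb{R}^E\times(0,\infty)^V$, and the set of parameters where the inequality is strict is an algebraic subset of the parameter space of positive codimension, namely the zero set in it of a nonzero real polynomial in $(\lambda,\phi)$. -/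

import Mathlib

open MeasureTheory ProbabilityTheory

/-- A directed acyclic graph on `V`: a directed graph (no multiple edges) with no directed cycle,
in particular with no loops. -/
structure DAG (V : Type*) extends Digraph V where
  acyclic : ∀ v, ¬ Relation.TransGen Adj v v

namespace DAG

variable {V : Type*}

/-! ### Treks and `t`-separation -/

/-- `p` is the list of successive vertices of a directed path with source `k` and sink `i`.
The list is nonempty; a single vertex is a path with no edges. By acyclicity the vertices on it
are automatically distinct. -/
structure IsPath (G : DAG V) (k i : V) (p : List V) : Prop where
  source : p.head? = some k
  sink : p.getLast? = some i
  chain : p.IsChain G.Adj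

/-- A trek from `i` to `j`: an ordered pair of directed paths with a common source `top`,
the first with sink `i` and the second with sink `j`. -/
structure Trek (G : DAG V) (i j : V) where
  top : V
  P₁ : List V
  P₂ : List V
  isPath₁ : G.IsPath top i P₁
  isPath₂ : G.IsPath top j P₂

/-- The pair `(CA, CB)` `t`-separates `A` from `B`. -/
def TSeparates (G : DAG V) (CA CB A B : Finset V) : Prop :=
  ∀ a ∈ A, ∀ b ∈ B, ∀ T : G.Trek a b, (∃ v ∈ T.P₁, v ∈ CA) ∨ (∃ v ∈ T.P₂, v ∈ CB)

/-- The sizes `#CA + #CB` of the pairs `(CA, CB)` that `t`-separate `A` from `B`. -/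
def tSepSizes (G : DAG V) (A B : Finset V) : Set ℕ :=
  {n | ∃ CA CB : Finset V, G.TSeparates CA CB A B ∧ CA.card + CB.card = n}

/-! ### The Gaussian model -/

/-- The edges of `G`. -/
abbrev Edge (G : DAG V) : Type _ := {e : V × V // G.Adj e.1 e.2}

/-- The parameter space, with its product topology: an arbitrary real regression coefficient
for each edge and a positive error variance for each vertex. -/
abbrev Param (G : DAG V) : Type _ := (G.Edge → ℝ) × (V → Set.Ioi (0 : ℝ))

/-- The coordinates of a parameter, as a point of the affine space indexed by edges and vertices. -/
def Param.coords {G : DAG V} (θ : G.Param) : G.Edge ⊕ V → ℝ :=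
  Sum.elim θ.1 (fun i => (θ.2 i : ℝ))

/-- The joint law of the errors `ε`: independent, with `ε i` normal of mean zero and variance
`φ i`. -/
noncomputable def errorLaw [Fintype V] (G : DAG V) (θ : G.Param) : Measure (V → ℝ) :=
  Measure.pi fun i => gaussianReal 0 (θ.2 i : ℝ).toNNReal

theorem wellFounded_adj [Finite V] (G : DAG V) : WellFounded G.Adj := by
  have : Std.Irrefl (Relation.TransGen G.Adj) := ⟨G.acyclic⟩
  exact Subrelation.wf (fun h => Relation.TransGen.single h)
    (Finite.wellFounded_of_trans_of_irrefl (Relation.TransGen G.Adj))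

open Classical in
/-- The random variables of the model, as functions of the errors `ε`, given by recursive
regression: `X j = ∑ i ∈ pa(j), λ i j * X i + ε j` (see `randomVector_eq`). -/
noncomputable def randomVector [Fintype V] (G : DAG V) (θ : G.Param) (ε : V → ℝ) : V → ℝ :=
  G.wellFounded_adj.fix fun j X =>
    ∑ i : {i // G.Adj i j}, θ.1 ⟨(i.1, j), i.2⟩ * X i.1 i.2 + ε j

open Classical in
theorem randomVector_eq [Fintype V] (G : DAG V) (θ : G.Param) (ε : V → ℝ) (j : V) :
    G.randomVector θ ε j =
      ∑ i : {i // G.Adj i j}, θ.1 ⟨(i.1, j), i.2⟩ * G.randomVector θ ε i.1 + ε j :=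
  WellFounded.fix_eq _ _ _

/-- The covariance matrix of the random vector `X` with parameter `θ`. -/
noncomputable def covMatrix [Fintype V] (G : DAG V) (θ : G.Param) : Matrix V V ℝ :=
  Matrix.of fun i j =>
    cov[fun ε => G.randomVector θ ε i, fun ε => G.randomVector θ ε j; G.errorLaw θ]

/-- The Gaussian model of `G`: all covariance matrices consistent with `G`. -/
def gaussianModel [Fintype V] (G : DAG V) : Set (Matrix V V ℝ) :=
  Set.range G.covMatrix

/-- A property of parameters is generic if it holds on a dense open subset of the parameter
space. -/
def IsGeneric (G : DAG V) (P : G.Param → Prop) : Prop :=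
  ∃ U : Set G.Param, IsOpen U ∧ Dense U ∧ ∀ θ ∈ U, P θ

end DAG

/-- The rank of the submatrix of `M` with row index set `A` and column index set `B`. -/
noncomputable def subRank {V : Type*} (M : Matrix V V ℝ) (A B : Finset V) : ℕ :=
  (M.submatrix (fun a : A => (a : V)) (fun b : B => (b : V))).rank

/-!
The covariance matrix is `Σ = Nᵀ Φ N`, where `Λ` is the matrix of edge coefficients, `Φ` the diagonal
matrix of error variances and `N = (1 - Λ)⁻¹` the path matrix, whose entry at `(k, i)` sums the weights
of the directed paths from `k` to `i` (`DAG.covMatrix_eq`).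

*Upper bound.* For any set `C`, cutting each path at its last vertex in `C` expresses `N` as the sum of
the paths that avoid `C` and a matrix that factors through the rows in `C`
(`SupportedOn.exists_factor`). If `(CA, CB)` `t`-separates `A` from `B`, then the treks that avoid the
pair contribute nothing, and what is left of `Σ_{A,B}` factors through a space of dimension
`#CA + #CB` (`DAG.subRank_le_of_tSeparates`).

*Lower bound.* Treks are the directed paths of a doubled acyclic graph, and `t`-separating pairs are its
vertex cuts. The rank form of Menger's theorem, `exists_le_subRank`, says that in an acyclic graph
whose cuts between `A` and `B` all have at least `k` vertices the submatrix `N_{A,B}` has rank at least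
`k` for suitable weights. It is proved by deleting an edge, as in Menger's own proof, but instead of
joining two systems of disjoint paths at a cut it multiplies an injective matrix by one of rank `k`
(`SupportedOn.exists_gluing`). In the doubled graph this gives an invertible `k × k` block of
`N₁ᵀ Φ N₂` for two unrelated weight matrices. By the Cauchy-Binet formula some `k` trek tops `s` give
invertible blocks of both `N₁` and `N₂`, and a generic point on the line through the two weight matrices
makes both blocks invertible at once (`DAG.exists_weights`). With error variance one at the vertices
of `s` and zero elsewhere the corresponding minor of `Σ` is the product of the two determinants, so it
is a nonzero polynomial in the parameters (`DAG.minorPoly_ne_zero`).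

The polynomial cutting out the parameters of deficient rank is the sum of the squares of the minors.
Its zero set is closed with dense complement, since a nonzero polynomial does not vanish on a box with
infinite sides.
-/

section

open Matrix

/-! ### Minors and rank -/

namespace Matrix

theorem exists_cols_of_le_rank {m n : Type*} [Fintype m] [Fintype n] (M : Matrix m n ℝ) {k : ℕ}
    (h : k ≤ M.rank) : ∃ g : Fin k → n, LinearIndependent ℝ (M.submatrix id g).col := by
  rw [rank_eq_finrank_span_cols] at h
  obtain ⟨f, hf, -, hli⟩ := Submodule.exists_fun_fin_finrank_span_eq ℝ (Set.range M.col)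
  choose g hg using hf
  refine ⟨fun i => g (Fin.castLE h i), ?_⟩
  have h2 := hli.comp (Fin.castLE h) (Fin.castLE_injective h)
  have h3 : (M.submatrix id fun i => g (Fin.castLE h i)).col = f ∘ Fin.castLE h := by
    funext i
    exact hg _
  rw [h3]
  exact h2

theorem le_rank_iff_exists_minor {m n : Type*} [Fintype m] [Fintype n] (M : Matrix m n ℝ) (k : ℕ) :
    k ≤ M.rank ↔ ∃ (f : Fin k → m) (g : Fin k → n), (M.submatrix f g).det ≠ 0 := by
  constructor
  · intro h
    obtain ⟨g, hg⟩ := M.exists_cols_of_le_rank h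
    have h1 : k ≤ (M.submatrix id g)ᵀ.rank := by
      rw [rank_transpose, rank_eq_finrank_span_cols, finrank_span_eq_card hg, Fintype.card_fin]
    obtain ⟨f, hf⟩ := exists_cols_of_le_rank _ h1
    refine ⟨f, g, ?_⟩
    rw [← det_transpose]
    have := linearIndependent_cols_iff_isUnit.1 hf
    exact ((isUnit_iff_isUnit_det _).1 this).ne_zero
  · rintro ⟨f, g, h⟩
    have := rank_of_det_ne_zero h
    rw [Fintype.card_fin] at this
    exact this ▸ rank_submatrix_le M f g

/-- Multiplication on the left by a matrix of full column rank preserves the rank. -/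
theorem rank_mul_eq_right_of_card_le_rank {l m n : Type*} [Fintype l] [Fintype m] [Fintype n]
    (M : Matrix l m ℝ) (N : Matrix m n ℝ) (h : Fintype.card m ≤ M.rank) :
    (M * N).rank = N.rank := by
  have hinj : Function.Injective M.mulVecLin := by
    rw [← LinearMap.ker_eq_bot]
    have h1 := M.mulVecLin.finrank_range_add_finrank_ker
    rw [Module.finrank_fintype_fun_eq_card] at h1
    have h2 : Module.finrank ℝ (LinearMap.ker M.mulVecLin) = 0 := by
      unfold rank at h; omega
    exact Submodule.finrank_eq_zero.1 h2
  rw [rank, rank, mulVecLin_mul, LinearMap.range_comp]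
  exact (Submodule.equivMapOfInjective _ hinj _).finrank_eq.symm

/-- The Cauchy-Binet formula, summed over all maps `s` instead of over the `k`-subsets: maps that are
not injective contribute zero, and each subset is counted `k!` times. -/
theorem factorial_mul_det_mul {n : Type*} [Fintype n] {k : ℕ} (X : Matrix (Fin k) n ℝ)
    (Y : Matrix n (Fin k) ℝ) :
    (k.factorial : ℝ) * (X * Y).det =
      ∑ s : Fin k → n, (X.submatrix id s).det * (Y.submatrix s id).det := by
  classical
  have h1 : (X * Y).det = ∑ s : Fin k → n, (∏ i, Y (s i) i) * (X.submatrix id s).det := by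
    simp only [det_apply', mul_apply, Finset.prod_univ_sum, Finset.mul_sum, Fintype.piFinset_univ,
      submatrix_apply, id]
    rw [Finset.sum_comm]
    refine Finset.sum_congr rfl fun s _ => Finset.sum_congr rfl fun σ _ => ?_
    rw [Finset.prod_mul_distrib]; ring
  have h2 (τ : Equiv.Perm (Fin k)) : (X * Y).det =
      ∑ s : Fin k → n, (X.submatrix id s).det * ((Equiv.Perm.sign τ : ℤ) * ∏ i, Y (s (τ i)) i) := by
    rw [h1, ← Equiv.sum_comp (Equiv.arrowCongr τ.symm (Equiv.refl n))]
    refine Finset.sum_congr rfl fun s _ => ?_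
    have : X.submatrix id ((τ.symm.arrowCongr (Equiv.refl n)) s) =
        (X.submatrix id s).submatrix id τ := rfl
    rw [this, det_permute']
    simp [Equiv.arrowCongr]
    ring
  calc (k.factorial : ℝ) * (X * Y).det = ∑ _τ : Equiv.Perm (Fin k), (X * Y).det := by
        simp [Fintype.card_perm]
    _ = _ := by
        rw [Finset.sum_congr rfl fun τ _ => h2 τ, Finset.sum_comm]
        refine Finset.sum_congr rfl fun s _ => ?_
        rw [← Finset.mul_sum, det_apply' (Y.submatrix s id)]
        rfl

theorem exists_common_minor {n : Type*} [Fintype n] {k : ℕ} (X : Matrix (Fin k) n ℝ)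
    (Y : Matrix n (Fin k) ℝ) (h : (X * Y).det ≠ 0) :
    ∃ s : Fin k → n, (X.submatrix id s).det ≠ 0 ∧ (Y.submatrix s id).det ≠ 0 := by
  have h1 : (k.factorial : ℝ) * (X * Y).det ≠ 0 :=
    mul_ne_zero (by exact_mod_cast k.factorial_ne_zero) h
  rw [factorial_mul_det_mul] at h1
  obtain ⟨s, -, hs⟩ := Finset.exists_ne_zero_of_sum_ne_zero h1
  exact ⟨s, left_ne_zero_of_mul hs, right_ne_zero_of_mul hs⟩

theorem det_submatrix_inv_ne_zero_iff {n : Type*} [Fintype n] [DecidableEq n] {k : ℕ}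
    {M : Matrix n n ℝ} (hM : M.det ≠ 0) (f g : Fin k → n) :
    (M⁻¹.submatrix f g).det ≠ 0 ↔ (M.adjugate.submatrix f g).det ≠ 0 := by
  have : M⁻¹.submatrix f g = M.det⁻¹ • M.adjugate.submatrix f g := by
    rw [inv_def, Ring.inverse_eq_inv']
    rfl
  rw [this, det_smul]
  simp [hM]

/-- If a minor of the inverse is nonzero at one end of a line of invertible matrices, and another
minor at another point of the line, then both are nonzero at some point: they agree up to nonzero
factors with minors of the adjugate, which are polynomials on the line. -/
theorem exists_common_point {n : Type*} [Fintype n] [DecidableEq n] {k l : ℕ}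
    (P Q : Matrix n n ℝ) (hdet : ∀ s : ℝ, (P + s • Q).det ≠ 0)
    (f g : Fin k → n) (f' g' : Fin l → n) (h₀ : (P⁻¹.submatrix f g).det ≠ 0)
    (h₁ : ((P + Q)⁻¹.submatrix f' g').det ≠ 0) :
    ∃ s : ℝ, ((P + s • Q)⁻¹.submatrix f g).det ≠ 0 ∧
      ((P + s • Q)⁻¹.submatrix f' g').det ≠ 0 := by
  open Polynomial in
  let L : Matrix n n ℝ[X] := P.map C + (X : ℝ[X]) • Q.map C
  have hL (s : ℝ) : (evalRingHom s).mapMatrix L = P + s • Q := by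
    ext i j; simpa [L] using mul_comm _ _
  have key {r : ℕ} (a b : Fin r → n) (s : ℝ) :
      ((L.adjugate.submatrix a b).det).eval s ≠ 0 ↔ ((P + s • Q)⁻¹.submatrix a b).det ≠ 0 := by
    rw [det_submatrix_inv_ne_zero_iff (hdet s), ← hL, ← RingHom.map_adjugate, ← coe_evalRingHom,
      RingHom.map_det]
    rfl
  have e₀ : (L.adjugate.submatrix f g).det ≠ 0 := fun h0 =>
    (key f g 0).2 (by simpa using h₀) (by simp [h0])
  have e₁ : (L.adjugate.submatrix f' g').det ≠ 0 := fun h0 =>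
    (key f' g' 1).2 (by simpa using h₁) (by simp [h0])
  obtain ⟨s, hs⟩ : ∃ s : ℝ, ((L.adjugate.submatrix f g).det *
      (L.adjugate.submatrix f' g').det).eval s ≠ 0 := by
    by_contra! h
    exact mul_ne_zero e₀ e₁ (Polynomial.funext (by simpa using h))
  rw [eval_mul] at hs
  exact ⟨s, (key f g s).1 (left_ne_zero_of_mul hs), (key f' g' s).1 (right_ne_zero_of_mul hs)⟩

end Matrix

/-! ### Path matrices of acyclic relations -/

section Separation

variable {W : Type*}

/-- `AvoidReach R C a b`: some directed path of `R` from `a` to `b`, possibly with no edges, has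
all its vertices outside `C`. -/
def AvoidReach (R : W → W → Prop) (C : Finset W) (a b : W) : Prop :=
  a ∉ C ∧ Relation.ReflTransGen (fun u v => R u v ∧ v ∉ C) a b

/-- `C` meets every directed path of `R` from a vertex in `A` to a vertex in `B`, endpoints
included. -/
def VertexSeparates (R : W → W → Prop) (C A B : Finset W) : Prop :=
  ∀ a ∈ A, ∀ b ∈ B, ¬ AvoidReach R C a b

/-- The weight matrix `Λ` vanishes off the edges of `R`. -/
def SupportedOn (R : W → W → Prop) (Λ : Matrix W W ℝ) : Prop :=
  ∀ i j, ¬ R i j → Λ i j = 0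

theorem AvoidReach.anti {R : W → W → Prop} {C C' : Finset W} (hC : C' ⊆ C) {a b : W}
    (h : AvoidReach R C a b) : AvoidReach R C' a b :=
  ⟨fun h' => h.1 (hC h'),
    Relation.ReflTransGen.mono (fun _ _ h' => ⟨h'.1, fun hv => h'.2 (hC hv)⟩) _ _ h.2⟩

theorem AvoidReach.right_notMem {R : W → W → Prop} {C : Finset W} {a b : W}
    (h : AvoidReach R C a b) : b ∉ C := by
  obtain ⟨ha, hab⟩ := h
  cases hab with
  | refl => exact ha
  | tail _ h => exact h.2

theorem AvoidReach.tail {R : W → W → Prop} {C : Finset W} {a b c : W}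
    (h : AvoidReach R C a b) (hbc : R b c) (hc : c ∉ C) : AvoidReach R C a c :=
  ⟨h.1, h.2.tail ⟨hbc, hc⟩⟩

/-- A path that avoids `C` either avoids the edge from `x` to `y`, or contains a path to `x` and a
path from `y` that do. -/
theorem AvoidReach.erase_edge {R : W → W → Prop} {C : Finset W} {a b : W} (x y : W)
    (h : AvoidReach R C a b) :
    AvoidReach (fun u v => R u v ∧ ¬ (u = x ∧ v = y)) C a b ∨
      (AvoidReach (fun u v => R u v ∧ ¬ (u = x ∧ v = y)) C a x ∧
        AvoidReach (fun u v => R u v ∧ ¬ (u = x ∧ v = y)) C y b) := by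
  obtain ⟨ha, hab⟩ := h
  induction hab with
  | refl => exact .inl ⟨ha, .refl⟩
  | @tail c d _ hcd ih =>
    by_cases hxy : c = x ∧ d = y
    · obtain ⟨rfl, rfl⟩ := hxy
      exact .inr ⟨ih.elim id And.left, hcd.2, .refl⟩
    · exact ih.imp (·.tail ⟨hcd.1, hxy⟩ hcd.2) fun h => ⟨h.1, h.2.tail ⟨hcd.1, hxy⟩ hcd.2⟩

/-- A path that avoids `C` either avoids `S` as well, or has an initial segment that ends in `S`
and a final segment that begins in `S`. -/
theorem AvoidReach.avoid_or_meet {R : W → W → Prop} {C : Finset W} (S : Finset W)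
    {a b : W} (h : AvoidReach R C a b) :
    AvoidReach R S a b ∨ ∃ s ∈ S, AvoidReach R C a s ∧ AvoidReach R C s b := by
  obtain ⟨ha, hab⟩ := h
  induction hab with
  | refl =>
    by_cases h : a ∈ S
    · exact .inr ⟨a, h, ⟨ha, .refl⟩, ha, .refl⟩
    · exact .inl ⟨h, .refl⟩
  | @tail c d hac hcd ih =>
    obtain ih | ⟨s, hs, h1, h2⟩ := ih
    · by_cases h : d ∈ S
      · exact .inr ⟨d, h, ⟨ha, hac.tail hcd⟩, hcd.2, .refl⟩
      · exact .inl (ih.tail hcd.1 h)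
    · exact .inr ⟨s, hs, h1, h2.tail hcd.1 hcd.2⟩

theorem le_subRank_of_det_ne_zero {M : Matrix W W ℝ} {A B : Finset W} {k : ℕ} {f g : Fin k → W}
    (hf : ∀ i, f i ∈ A) (hg : ∀ i, g i ∈ B) (h : (M.submatrix f g).det ≠ 0) :
    k ≤ subRank M A B :=
  (le_rank_iff_exists_minor _ k).2 ⟨fun i => ⟨f i, hf i⟩, fun i => ⟨g i, hg i⟩, h⟩

theorem le_subRank_iff {M : Matrix W W ℝ} {A B : Finset W} {k : ℕ} :
    k ≤ subRank M A B ↔ ∃ (f : Fin k → A) (g : Fin k → B),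
      (M.submatrix (fun i => (f i : W)) (fun i => (g i : W))).det ≠ 0 :=
  le_rank_iff_exists_minor _ k

theorem SupportedOn.line {R : W → W → Prop} {Λ₀ Λ₁ : Matrix W W ℝ}
    (h₀ : SupportedOn R Λ₀) (h₁ : SupportedOn R Λ₁) (s : ℝ) :
    SupportedOn R (Λ₀ + s • (Λ₁ - Λ₀)) := fun i j hij => by
  simp [h₀ i j hij, h₁ i j hij]

variable [Fintype W] [DecidableEq W]

theorem SupportedOn.det_one_sub_ne_zero {R : W → W → Prop} (hR : WellFounded R)
    {Λ : Matrix W W ℝ} (hΛ : SupportedOn R Λ) : (1 - Λ).det ≠ 0 := by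
  intro h
  obtain ⟨v, hv, h0⟩ := Matrix.exists_vecMul_eq_zero_iff.2 h
  refine hv (funext fun j => ?_)
  induction j using hR.induction with
  | h j ih =>
    have h1 := congrFun h0 j
    rw [vecMul_sub, vecMul_one, Pi.sub_apply] at h1
    have h2 : (v ᵥ* Λ) j = 0 := by
      refine Finset.sum_eq_zero fun i _ => ?_
      by_cases hij : R i j
      · simp [ih i hij]
      · simp [hΛ i j hij]
    simpa [h2] using h1

theorem SupportedOn.inv_mul {R : W → W → Prop} (hR : WellFounded R)
    {Λ : Matrix W W ℝ} (hΛ : SupportedOn R Λ) : (1 - Λ)⁻¹ * (1 - Λ) = 1 :=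
  nonsing_inv_mul _ (hΛ.det_one_sub_ne_zero hR).isUnit

theorem SupportedOn.mul_inv {R : W → W → Prop} (hR : WellFounded R)
    {Λ : Matrix W W ℝ} (hΛ : SupportedOn R Λ) : (1 - Λ) * (1 - Λ)⁻¹ = 1 :=
  mul_nonsing_inv _ (hΛ.det_one_sub_ne_zero hR).isUnit

/-- The recursion for the path matrix: a path to `b` is trivial or extends a path to a parent of `b`. -/
theorem SupportedOn.inv_apply {R : W → W → Prop} (hR : WellFounded R)
    {Λ : Matrix W W ℝ} (hΛ : SupportedOn R Λ) (k b : W) :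
    (1 - Λ)⁻¹ k b = (1 : Matrix W W ℝ) k b + ∑ j, (1 - Λ)⁻¹ k j * Λ j b := by
  have h := congrFun (congrFun (hΛ.inv_mul hR) k) b
  rw [mul_sub, mul_one, Matrix.sub_apply, mul_apply] at h
  linarith

/-- Decomposition of the path matrix by the last vertex in `C`: `w k b` stands for the paths from `k` to
`b` that avoid `C`, and `m c b` for the paths from `c` to `b` that do not return to `C`. -/
theorem SupportedOn.exists_factor {R : W → W → Prop} (hR : WellFounded R)
    {Λ : Matrix W W ℝ} (hΛ : SupportedOn R Λ) (C : Finset W) :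
    ∃ w m : Matrix W W ℝ,
      (∀ k b, (1 - Λ)⁻¹ k b = w k b + ∑ c ∈ C, (1 - Λ)⁻¹ k c * m c b) ∧
      ∀ k b, w k b ≠ 0 → AvoidReach R C k b := by
  suffices h : ∀ b, ∃ w m : W → ℝ,
      (∀ k, (1 - Λ)⁻¹ k b = w k + ∑ c ∈ C, (1 - Λ)⁻¹ k c * m c) ∧
      ∀ k, w k ≠ 0 → AvoidReach R C k b by
    choose w m h1 h2 using h
    exact ⟨fun k b => w b k, fun c b => m b c, fun k b => h1 b k, fun k b => h2 b k⟩
  intro b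
  induction b using hR.induction with
  | h b ih =>
    by_cases hb : b ∈ C
    · exact ⟨0, Pi.single b 1, fun k => by simp [Pi.single_apply, hb], by simp⟩
    have ih' : ∀ j, ∃ w m : W → ℝ, R j b →
        (∀ k, (1 - Λ)⁻¹ k j = w k + ∑ c ∈ C, (1 - Λ)⁻¹ k c * m c) ∧
        ∀ k, w k ≠ 0 → AvoidReach R C k j := by
      intro j
      by_cases hj : R j b
      · obtain ⟨w, m, h⟩ := ih j hj
        exact ⟨w, m, fun _ => h⟩
      · exact ⟨0, 0, fun h => absurd h hj⟩
    choose w m h using ih'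
    refine ⟨fun k => (1 : Matrix W W ℝ) k b + ∑ j, w j k * Λ j b,
      fun c => ∑ j, m j c * Λ j b, fun k => ?_, fun k hk => ?_⟩
    · rw [hΛ.inv_apply hR]
      simp only [Finset.mul_sum]
      rw [Finset.sum_comm, add_assoc, ← Finset.sum_add_distrib]
      congr 1
      refine Finset.sum_congr rfl fun j _ => ?_
      by_cases hj : R j b
      · rw [(h j hj).1 k, add_mul, Finset.sum_mul]
        congr 1
        exact Finset.sum_congr rfl fun c _ => by ring
      · simp [hΛ j b hj]
    · by_cases hkb : k = b
      · subst hkb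
        exact ⟨hb, .refl⟩
      · have h1 : ∑ j, w j k * Λ j b ≠ 0 := by simpa [Matrix.one_apply_ne hkb] using hk
        obtain ⟨j, -, hj⟩ := Finset.exists_ne_zero_of_sum_ne_zero h1
        have hjb : R j b := by
          by_contra hn
          exact right_ne_zero_of_mul hj (hΛ j b hn)
        exact ((h j hjb).2 k (left_ne_zero_of_mul hj)).tail hjb hb

/-- Path matrices with prescribed nonvanishing minors can be found for the same weights: both
minors are nonzero at all but finitely many points of the line through two weight matrices. -/
theorem SupportedOn.exists_common {R : W → W → Prop} (hR : WellFounded R) {Λ₀ Λ₁ : Matrix W W ℝ}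
    (h₀ : SupportedOn R Λ₀) (h₁ : SupportedOn R Λ₁) {k l : ℕ} {f g : Fin k → W} {f' g' : Fin l → W}
    (hm₀ : ((1 - Λ₀)⁻¹.submatrix f g).det ≠ 0) (hm₁ : ((1 - Λ₁)⁻¹.submatrix f' g').det ≠ 0) :
    ∃ Λ, SupportedOn R Λ ∧ ((1 - Λ)⁻¹.submatrix f g).det ≠ 0 ∧
      ((1 - Λ)⁻¹.submatrix f' g').det ≠ 0 := by
  have e (s : ℝ) : (1 - Λ₀) + s • (Λ₀ - Λ₁) = 1 - (Λ₀ + s • (Λ₁ - Λ₀)) := by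
    rw [smul_sub, smul_sub]; abel
  obtain ⟨s, hs, hs'⟩ := exists_common_point (1 - Λ₀) (Λ₀ - Λ₁)
    (fun s => by rw [e]; exact (h₀.line h₁ s).det_one_sub_ne_zero hR) f g f' g' hm₀
    (by rwa [sub_add_sub_cancel])
  rw [e] at hs hs'
  exact ⟨_, h₀.line h₁ s, hs, hs'⟩

/-- The inductive step of Menger's theorem in terms of rank. Let `S` separate `A` from `B` before the
edge from `x` to `y` is added. If the path matrices from `A` to `S ∪ {x}` and from `S ∪ {y}` to `B` have
rank more than `#S`, then so does the path matrix from `A` to `B` once the edge is there. -/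
theorem SupportedOn.exists_gluing {R : W → W → Prop} (hR : WellFounded R) {Λ : Matrix W W ℝ}
    (hΛ : SupportedOn R Λ) {A B S : Finset W} (hS : VertexSeparates R S A B) {x y : W}
    (hxy : (1 - (Λ + Matrix.single x y 1)).det ≠ 0)
    (hA : S.card + 1 ≤ subRank (1 - Λ)⁻¹ A (insert x S))
    (hB : S.card + 1 ≤ subRank (1 - Λ)⁻¹ (insert y S) B) :
    S.card + 1 ≤ subRank (1 - (Λ + Matrix.single x y 1))⁻¹ A B := by
  obtain ⟨w, m, hN, hw⟩ := hΛ.exists_factor hR S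
  set N := (1 - Λ)⁻¹
  set N' := (1 - (Λ + Matrix.single x y 1))⁻¹
  -- The resolvent identity: cut the paths at their first use of the new edge.
  have hNN' : N' = N + N * Matrix.single x y 1 * N' := by
    have h1 : N * (1 - Λ) = 1 := hΛ.inv_mul hR
    have h2 : (1 - (Λ + Matrix.single x y 1)) * N' = 1 := mul_nonsing_inv _ hxy.isUnit
    have h3 : N * ((1 - Λ) - Matrix.single x y 1) * N' = N := by
      rw [sub_sub, mul_assoc, h2, mul_one]
    rw [mul_sub, h1, sub_mul, one_mul] at h3
    exact eq_add_of_sub_eq h3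
  have hN' (i j : W) : N' i j = N i j + N i x * N' y j := by
    conv_lhs => rw [hNN']
    rw [Matrix.add_apply, mul_assoc, mul_apply]
    congr 1
    rw [Finset.sum_eq_single x]
    · simp
    · intro b _ hb
      simp [hb]
    · simp
  -- `Option S` stands for `S ∪ {x}` as the column index of `F`, and for `S ∪ {y}` as the row index
  -- of `H`, whose rows at `S` count the paths by their last vertex in `S`.
  let F : Matrix A (Option S) ℝ := of fun a o => o.elim (N a x) fun s => N a s
  let H : Matrix (Option S) B ℝ := of fun o b => o.elim (N' y b) fun s => m s b
  have hFH : N'.submatrix (fun a : A => (a : W)) (fun b : B => (b : W)) = F * H := by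
    ext a b
    have h0 : w a b = 0 := by
      by_contra h
      exact hS a a.2 b b.2 (hw a b h)
    rw [submatrix_apply, hN', hN, h0, mul_apply, Fintype.sum_option,
      ← Finset.sum_coe_sort S (fun c => N a c * m c b)]
    simp [F, H, add_comm]
  have hcard : Fintype.card (Option S) = S.card + 1 := by simp
  have hF : S.card + 1 ≤ F.rank := by
    refine hA.trans ?_
    let e : ↥(insert x S) → Option S :=
      fun v => if h : (v : W) ∈ S then some ⟨v, h⟩ else none
    have : N.submatrix (fun a : A => (a : W)) (fun b : ↥(insert x S) => (b : W)) =
        F.submatrix id e := by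
      ext a v
      by_cases h : (v : W) ∈ S
      · simp [F, e, h]
      · have : (v : W) = x := (Finset.mem_insert.1 v.2).resolve_right h
        have hxS : x ∉ S := this ▸ h
        simp [F, e, hxS, this]
    rw [subRank, this]
    exact rank_submatrix_le F id e
  have hH : S.card + 1 ≤ H.rank := by
    refine hB.trans ?_
    -- `N_{S ∪ {y}, B}` is a left multiple of `H`: no path from `S` avoids `S`, and the rows of `N`
    -- and `N'` at `y` are proportional by the resolvent identity.
    let T : Matrix ↥(insert y S) (Option S) ℝ := of fun v o =>
      if (v : W) ∈ S then o.elim 0 fun s => N v s else o.elim (1 - N y x) fun _ => 0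
    have : N.submatrix (fun a : ↥(insert y S) => (a : W)) (fun b : B => (b : W)) =
        T * H := by
      ext v b
      rw [submatrix_apply, mul_apply, Fintype.sum_option]
      by_cases h : (v : W) ∈ S
      · have h0 : w v b = 0 := by
          by_contra h'
          exact (hw v b h').1 h
        rw [hN, h0, ← Finset.sum_coe_sort S (fun c => N v c * m c b)]
        simp [T, H, h]
      · have hv : (v : W) = y := (Finset.mem_insert.1 v.2).resolve_right h
        have := hN' y b
        have hyS : y ∉ S := hv ▸ h
        simp only [T, H, of_apply, hv, if_neg hyS, Option.elim, zero_mul, Finset.sum_const_zero]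
        linarith
    rw [subRank, this]
    exact rank_mul_le_right T H
  rw [subRank, hFH, rank_mul_eq_right_of_card_le_rank F H (hcard ▸ hF)]
  exact hH

/-- Menger's theorem in terms of rank: if every set that separates `A` from `B` has at least `k`
elements, then the path matrix from `A` to `B` has rank at least `k` for suitable weights. -/
theorem exists_le_subRank {R : W → W → Prop} (hR : WellFounded R) (A B : Finset W) (k : ℕ)
    (h : ∀ C, VertexSeparates R C A B → k ≤ C.card) :
    ∃ Λ, SupportedOn R Λ ∧ k ≤ subRank (1 - Λ)⁻¹ A B := by
  induction hn : {e : W × W | R e.1 e.2}.ncard using Nat.strong_induction_on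
    generalizing R A B with
  | h n ih =>
  obtain hE | ⟨⟨x, y⟩, hxy⟩ := {e : W × W | R e.1 e.2}.eq_empty_or_nonempty
  · have hno (u v : W) : ¬ R u v := fun h => (hE ▸ h : (u, v) ∈ (∅ : Set (W × W)))
    refine ⟨0, fun _ _ _ => rfl, ?_⟩
    have hsep : VertexSeparates R (A ∩ B) A B := by
      rintro a ha b hb ⟨hab, h⟩
      obtain h | ⟨c, -, h⟩ := h.cases_tail
      · exact hab (Finset.mem_inter.2 ⟨ha, h ▸ hb⟩)
      · exact hno _ _ h.1
    refine (h _ hsep).trans ?_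
    let f : Fin (A ∩ B).card → W := fun i => (A ∩ B).equivFin.symm i
    have hf (i) : f i ∈ A ∩ B := ((A ∩ B).equivFin.symm i).2
    refine le_subRank_of_det_ne_zero (f := f) (g := f) (fun i => (Finset.mem_inter.1 (hf i)).1)
      (fun i => (Finset.mem_inter.1 (hf i)).2) ?_
    have hinj : Function.Injective f :=
      Subtype.val_injective.comp (A ∩ B).equivFin.symm.injective
    rw [sub_zero, inv_one, submatrix_one f hinj, det_one]
    exact one_ne_zero
  -- Delete an edge. If a cut `S` with fewer than `k` vertices appears, then `#S + 1 = k`, and cuts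
  -- between `A` and `S ∪ {x}`, or between `S ∪ {y}` and `B`, in the smaller graph are cuts of `R`.
  · change R x y at hxy
    let R' : W → W → Prop := fun u v => R u v ∧ ¬ (u = x ∧ v = y)
    have hR' : WellFounded R' := Subrelation.wf (fun h => h.1) hR
    have hlt : {e : W × W | R' e.1 e.2}.ncard < n := by
      rw [← hn]
      refine Set.ncard_lt_ncard ⟨fun e he => he.1, fun hs => ?_⟩ (Set.toFinite _)
      exact (hs (show (x, y) ∈ {e : W × W | R e.1 e.2} from hxy)).2 ⟨rfl, rfl⟩
    by_cases hS : ∀ C, VertexSeparates R' C A B → k ≤ C.card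
    · obtain ⟨Λ, hΛ, hk⟩ := ih _ hlt hR' A B hS rfl
      exact ⟨Λ, fun i j hij => hΛ i j fun h => hij h.1, hk⟩
    push Not at hS
    obtain ⟨S, hS, hSk⟩ := hS
    have hx : VertexSeparates R (insert x S) A B := by
      intro a ha b hb hab
      obtain h | h := hab.erase_edge x y
      · exact hS a ha b hb (h.anti (Finset.subset_insert _ _))
      · exact h.1.right_notMem (Finset.mem_insert_self _ _)
    have hSk' : S.card + 1 = k :=
      le_antisymm hSk ((h _ hx).trans (Finset.card_insert_le _ _))
    obtain ⟨Λ₁, hΛ₁, hk₁⟩ := ih _ hlt hR' A (insert x S) (fun C hC => h C fun a ha b hb hab => by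
      obtain h | h := hab.erase_edge x y
      · obtain h' | ⟨s, hs, h', -⟩ := h.avoid_or_meet S
        · exact hS a ha b hb h'
        · exact hC a ha s (Finset.mem_insert_of_mem hs) h'
      · exact hC a ha x (Finset.mem_insert_self _ _) h.1) rfl
    obtain ⟨Λ₂, hΛ₂, hk₂⟩ := ih _ hlt hR' (insert y S) B (fun C hC => h C fun a ha b hb hab => by
      obtain h | h := hab.erase_edge x y
      · obtain h' | ⟨s, hs, -, h'⟩ := h.avoid_or_meet S
        · exact hS a ha b hb h'
        · exact hC s (Finset.mem_insert_of_mem hs) b hb h'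
      · exact hC y (Finset.mem_insert_self _ _) b hb h.2) rfl
    obtain ⟨f, g, hfg⟩ := le_subRank_iff.1 hk₁
    obtain ⟨f', g', hfg'⟩ := le_subRank_iff.1 hk₂
    obtain ⟨Λ, hΛ, h1, h2⟩ := hΛ₁.exists_common hR' hΛ₂ hfg hfg'
    have hsup : SupportedOn R (Λ + Matrix.single x y 1) := by
      intro i j hij
      have h3 : ¬ (x = i ∧ y = j) := by
        rintro ⟨rfl, rfl⟩
        exact hij hxy
      rw [Matrix.add_apply, hΛ i j fun h => hij h.1, single_apply_of_ne _ _ _ _ _ h3, add_zero]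
    refine ⟨_, hsup, ?_⟩
    rw [← hSk']
    refine hΛ.exists_gluing hR' hS (hsup.det_one_sub_ne_zero hR) ?_ ?_ <;> rw [hSk']
    · exact le_subRank_of_det_ne_zero (fun i => (f i).2) (fun i => (g i).2) h1
    · exact le_subRank_of_det_ne_zero (fun i => (f' i).2) (fun i => (g' i).2) h2

end Separation

namespace DAG

variable {V : Type*}

/-! ### Treks as directed paths -/

theorem wellFounded_adj_swap [Finite V] (G : DAG V) : WellFounded (fun u v => G.Adj v u) := by
  have : Std.Irrefl (Function.swap (Relation.TransGen G.Adj)) := ⟨G.acyclic⟩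
  have : IsTrans V (Function.swap (Relation.TransGen G.Adj)) := ⟨fun _ _ _ h h' => h'.trans h⟩
  exact Subrelation.wf (fun h => Relation.TransGen.single h)
    (Finite.wellFounded_of_trans_of_irrefl (Function.swap (Relation.TransGen G.Adj)))

theorem IsPath.avoidReach {G : DAG V} {C : Finset V} {k i : V} {p : List V} (h : G.IsPath k i p)
    (hp : ∀ v ∈ p, v ∉ C) : AvoidReach G.Adj C k i := by
  induction p generalizing k with
  | nil => simpa using h.source
  | cons x l ih =>
    obtain rfl : x = k := by simpa using h.source
    have hx : x ∉ C := hp x (by simp)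
    cases l with
    | nil =>
      obtain rfl : x = i := by simpa using h.sink
      exact ⟨hx, .refl⟩
    | cons y l =>
      have hc := List.isChain_cons_cons.1 h.chain
      have := ih ⟨rfl, by simpa using h.sink, hc.2⟩ fun v hv => hp v (List.mem_cons_of_mem _ hv)
      exact ⟨hx, .head ⟨hc.1, this.1⟩ this.2⟩

theorem exists_isPath_of_avoidReach {G : DAG V} {C : Finset V} {k i : V}
    (h : AvoidReach G.Adj C k i) : ∃ p, G.IsPath k i p ∧ ∀ v ∈ p, v ∉ C := by
  obtain ⟨hk, h⟩ := h
  induction h using Relation.ReflTransGen.head_induction_on with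
  | refl => exact ⟨[i], ⟨rfl, rfl, by simp⟩, by simpa using hk⟩
  | @head a c hac _ ih =>
    obtain ⟨p, hp, hpC⟩ := ih hac.2
    obtain ⟨l, rfl⟩ : ∃ l, p = c :: l := by
      cases p with
      | nil => simpa using hp.source
      | cons x l =>
        obtain rfl : x = c := by simpa using hp.source
        exact ⟨l, rfl⟩
    refine ⟨a :: c :: l, ⟨rfl, by simpa using hp.sink, hp.chain.cons_cons hac.1⟩, ?_⟩
    simpa [hk] using hpC

/-- A pair `t`-separates iff no vertex `k` is the top of a trek that avoids the pair. -/
theorem tSeparates_iff {G : DAG V} {CA CB A B : Finset V} :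
    G.TSeparates CA CB A B ↔ ∀ a ∈ A, ∀ b ∈ B, ∀ k,
      ¬ (AvoidReach G.Adj CA k a ∧ AvoidReach G.Adj CB k b) := by
  constructor
  · rintro h a ha b hb k ⟨h₁, h₂⟩
    obtain ⟨p, hp, hpC⟩ := exists_isPath_of_avoidReach h₁
    obtain ⟨q, hq, hqC⟩ := exists_isPath_of_avoidReach h₂
    obtain ⟨v, hv, hvC⟩ | ⟨v, hv, hvC⟩ := h a ha b hb ⟨k, p, q, hp, hq⟩
    · exact hpC v hv hvC
    · exact hqC v hv hvC
  · intro h a ha b hb T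
    by_contra hT
    push Not at hT
    exact h a ha b hb T.top ⟨T.isPath₁.avoidReach hT.1, T.isPath₂.avoidReach hT.2⟩

/-- The edges of the doubled graph on `V ⊕ V`: the reversed edges of `G` on the left copy, the edges
of `G` on the right copy, and an edge from each vertex of the left copy to its twin. The treks from
`a` to `b` are its directed paths from `inl a` to `inr b`. -/
def TrekAdj (G : DAG V) : V ⊕ V → V ⊕ V → Prop
  | .inl u, .inl v => G.Adj v u
  | .inl u, .inr v => u = v
  | .inr _, .inl _ => False
  | .inr u, .inr v => G.Adj u v

theorem wellFounded_trekAdj [Finite V] (G : DAG V) : WellFounded G.TrekAdj := by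
  refine Subrelation.wf ?_ (Sum.lex_wf G.wellFounded_adj_swap G.wellFounded_adj)
  rintro (u | u) (v | v) h
  · exact .inl h
  · exact .sep _ _
  · exact h.elim
  · exact .inr h

theorem tSeparates_of_vertexSeparates {G : DAG V} {C : Finset (V ⊕ V)} {A B : Finset V}
    (h : VertexSeparates G.TrekAdj C (A.map .inl) (B.map .inr)) :
    G.TSeparates C.toLeft C.toRight A B := by
  rw [tSeparates_iff]
  rintro a ha b hb k ⟨⟨hk₁, h₁⟩, hk₂, h₂⟩
  have ha' : AvoidReach G.TrekAdj C (.inl a) (.inl k) := by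
    clear ha hk₂ h₂
    induction h₁ with
    | refl => exact ⟨by simpa using hk₁, .refl⟩
    | @tail c d _ hcd ih =>
      exact ⟨by simpa using hcd.2, .head ⟨show G.TrekAdj (.inl d) (.inl c) from hcd.1, ih.1⟩ ih.2⟩
  have hb' : Relation.ReflTransGen (fun u v => G.TrekAdj u v ∧ v ∉ C) (.inr k) (.inr b) :=
    h₂.lift Sum.inr fun u v huv => ⟨huv.1, by simpa using huv.2⟩
  exact h (.inl a) (Finset.mem_map_of_mem _ ha) (.inr b) (Finset.mem_map_of_mem _ hb)
    ⟨ha'.1, (ha'.2.tail ⟨show G.TrekAdj (.inl k) (.inr k) from rfl, by simpa using hk₂⟩).trans hb'⟩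

/-! ### Zero sets of polynomials in the parameter space -/

theorem isOpen_eval_coords_ne_zero (G : DAG V) (p : MvPolynomial (G.Edge ⊕ V) ℝ) :
    IsOpen {θ : G.Param | MvPolynomial.eval θ.coords p ≠ 0} := by
  have hc : Continuous fun θ : G.Param => θ.coords := by
    refine continuous_pi fun i => ?_
    cases i with
    | inl e => exact (continuous_apply e).comp continuous_fst
    | inr v => exact continuous_subtype_val.comp ((continuous_apply v).comp continuous_snd)
  exact isOpen_ne.preimage (p.continuous_eval.comp hc)

/-- Each nonempty open set of parameters contains a box with infinite sides, on which a nonzero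
polynomial cannot vanish. -/
theorem dense_eval_coords_ne_zero (G : DAG V) {p : MvPolynomial (G.Edge ⊕ V) ℝ} (hp : p ≠ 0) :
    Dense {θ : G.Param | MvPolynomial.eval θ.coords p ≠ 0} := by
  rw [dense_iff_inter_open]
  rintro U hU ⟨θ, hθ⟩
  by_contra hempty
  obtain ⟨u, v, hu, hv, hθu, hθv, huv⟩ := isOpen_prod_iff.1 hU θ.1 θ.2 hθ
  obtain ⟨I, a, ha, haI⟩ := isOpen_pi_iff.1 hu θ.1 hθu
  obtain ⟨J, b, hb, hbJ⟩ := isOpen_pi_iff.1 hv θ.2 hθv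
  let s : G.Edge ⊕ V → Set ℝ := Sum.elim (fun e => {x | e ∈ I → x ∈ a e})
    (fun i => Subtype.val '' {x : Set.Ioi (0 : ℝ) | i ∈ J → x ∈ b i})
  have hs (i) : (s i).Infinite := by
    cases i with
    | inl e =>
      have ho : IsOpen {x | e ∈ I → x ∈ a e} := by
        by_cases he : e ∈ I
        · simpa [he] using (ha e he).1
        · simp [he]
      exact infinite_of_mem_nhds (θ.1 e) (ho.mem_nhds fun he => (ha e he).2)
    | inr i =>
      have ho : IsOpen {x : Set.Ioi (0 : ℝ) | i ∈ J → x ∈ b i} := by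
        by_cases hi : i ∈ J
        · simpa [hi] using (hb i hi).1
        · simp [hi]
      exact infinite_of_mem_nhds (θ.2 i : ℝ) ((isOpen_Ioi.isOpenMap_subtype_val _ ho).mem_nhds
        ⟨θ.2 i, fun hi => (hb i hi).2, rfl⟩)
  refine hp (MvPolynomial.funext_set s hs fun x hx => ?_)
  choose y hy hyx using fun i => hx (.inr i) (Set.mem_univ _)
  have hxy : x = DAG.Param.coords (G := G) (x ∘ .inl, y) := by
    funext i
    cases i with
    | inl e => rfl
    | inr i => exact (hyx i).symm
  have hU : ((x ∘ .inl, y) : G.Param) ∈ U :=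
    huv ⟨haI fun e he => hx (.inl e) (Set.mem_univ _) he, hbJ fun i hi => hy i hi⟩
  rw [map_zero, hxy]
  by_contra h
  exact hempty ⟨_, hU, h⟩

/-! ### The covariance matrix -/

open Classical in
/-- The matrix with the coefficient of the edge from `i` to `j` in position `(i, j)`, over any
ring. -/
noncomputable def edgeMatrix {K : Type*} [Zero K] (G : DAG V) (c : G.Edge → K) : Matrix V V K :=
  of fun i j => if h : G.Adj i j then c ⟨(i, j), h⟩ else 0

theorem supportedOn_edgeMatrix (G : DAG V) (c : G.Edge → ℝ) :
    SupportedOn G.Adj (G.edgeMatrix c) := fun i j h => by simp [edgeMatrix, h]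

variable [Fintype V]

theorem memLp_error (G : DAG V) (θ : G.Param) (k : V) :
    MemLp (fun ε : V → ℝ => ε k) 2 (G.errorLaw θ) :=
  (memLp_id_gaussianReal' 2 (by simp)).comp_measurePreserving
    (measurePreserving_eval (fun i => gaussianReal 0 (θ.2 i : ℝ).toNNReal) k)

instance (G : DAG V) (θ : G.Param) : IsProbabilityMeasure (G.errorLaw θ) := by
  unfold errorLaw; infer_instance

variable [DecidableEq V]

theorem randomVector_eq_vecMul (G : DAG V) (θ : G.Param) (ε : V → ℝ) :
    G.randomVector θ ε = ε ᵥ* (1 - G.edgeMatrix θ.1)⁻¹ := by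
  classical
  have h : G.randomVector θ ε ᵥ* (1 - G.edgeMatrix θ.1) = ε := by
    funext j
    rw [vecMul_sub, vecMul_one, Pi.sub_apply, sub_eq_iff_eq_add', randomVector_eq]
    congr 1
    rw [vecMul, dotProduct, ← Fintype.sum_subtype_add_sum_subtype (fun i => G.Adj i j),
      Fintype.sum_eq_zero (fun i : {i // ¬ G.Adj i j} => _) fun i => by simp [edgeMatrix, i.2],
      add_zero]
    refine Fintype.sum_equiv (Equiv.refl _) _ _ fun i => ?_
    simp [edgeMatrix, i.2, mul_comm]
  rw [← h, vecMul_vecMul, (G.supportedOn_edgeMatrix θ.1).mul_inv G.wellFounded_adj, vecMul_one, h]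

theorem covariance_error (G : DAG V) (θ : G.Param) (k l : V) :
    cov[fun ε => ε k, fun ε => ε l; G.errorLaw θ] = diagonal (fun v => (θ.2 v : ℝ)) k l := by
  by_cases hkl : k = l
  · subst hkl
    have hmp := measurePreserving_eval (fun i => gaussianReal 0 (θ.2 i : ℝ).toNNReal) k
    rw [covariance_self (measurable_pi_apply k).aemeasurable, diagonal_apply_eq]
    have := variance_map (X := id) (Y := fun ε : V → ℝ => ε k) (μ := G.errorLaw θ)
      (by fun_prop) (measurable_pi_apply k).aemeasurable
    rw [errorLaw, hmp.map_eq, variance_id_gaussianReal] at this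
    rw [Real.coe_toNNReal _ (θ.2 k).2.le] at this
    exact this.symm
  · rw [diagonal_apply_ne _ hkl]
    refine IndepFun.covariance_eq_zero ?_ (G.memLp_error θ k) (G.memLp_error θ l)
    exact (iIndepFun_pi (μ := fun i => gaussianReal 0 (θ.2 i : ℝ).toNNReal) (X := fun _ => id)
      fun _ => aemeasurable_id).indepFun hkl

theorem covMatrix_eq (G : DAG V) (θ : G.Param) :
    G.covMatrix θ = (1 - G.edgeMatrix θ.1)⁻¹ᵀ * diagonal (fun v => (θ.2 v : ℝ)) *
      (1 - G.edgeMatrix θ.1)⁻¹ := by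
  set N := (1 - G.edgeMatrix θ.1)⁻¹
  ext i j
  have h (i : V) : (fun ε => G.randomVector θ ε i) = fun ε => ∑ k, ε k * N k i := by
    funext ε
    rw [randomVector_eq_vecMul]
    rfl
  rw [covMatrix, of_apply, h, h, covariance_fun_sum_fun_sum
    (fun k => (G.memLp_error θ k).mul_const _) (fun k => (G.memLp_error θ k).mul_const _)]
  simp only [covariance_mul_const_left, covariance_mul_const_right, covariance_error]
  simp only [mul_apply, diagonal_apply, transpose_apply]
  simp
  exact Finset.sum_congr rfl fun _ _ => by ring

/-! ### Existence of invertible path matrices, and the rank bound -/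

/-- If every `t`-separating pair has at least `k` elements, then some weights and some `k` trek tops
`s` have path matrices from `s` to `k` vertices in `A` and from `s` to `k` vertices in `B` that are
both invertible. -/
theorem exists_weights {G : DAG V} {A B : Finset V} {k : ℕ}
    (h : ∀ CA CB, G.TSeparates CA CB A B → k ≤ CA.card + CB.card) :
    ∃ (Λ : Matrix V V ℝ) (s : Fin k → V) (f : Fin k → A) (g : Fin k → B), SupportedOn G.Adj Λ ∧
      ((1 - Λ)⁻¹.submatrix s (fun i => (f i : V))).det ≠ 0 ∧
      ((1 - Λ)⁻¹.submatrix s (fun i => (g i : V))).det ≠ 0 := by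
  obtain ⟨K, hK, hk⟩ := exists_le_subRank G.wellFounded_trekAdj (A.map .inl) (B.map .inr) k
    fun C hC => (h _ _ (tSeparates_of_vertexSeparates hC)).trans_eq
      Finset.card_toLeft_add_card_toRight
  obtain ⟨f', g', hdet⟩ := le_subRank_iff.1 hk
  have hf (i) : ∃ a : A, (f' i : V ⊕ V) = .inl (a : V) := by
    obtain ⟨a, ha, h⟩ := Finset.mem_map.1 (f' i).2
    exact ⟨⟨a, ha⟩, h.symm⟩
  have hg (i) : ∃ b : B, (g' i : V ⊕ V) = .inr (b : V) := by
    obtain ⟨b, hb, h⟩ := Finset.mem_map.1 (g' i).2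
    exact ⟨⟨b, hb⟩, h.symm⟩
  choose f hf using hf
  choose g hg using hg
  set Λ₁ : Matrix V V ℝ := K.toBlocks₁₁ᵀ with hΛ₁
  set Λ₂ : Matrix V V ℝ := K.toBlocks₂₂
  have s₁ : SupportedOn G.Adj Λ₁ := fun i j hij => hK (.inl j) (.inl i) hij
  have s₂ : SupportedOn G.Adj Λ₂ := fun i j hij => hK (.inr i) (.inr j) hij
  set φ : V → ℝ := fun v => K (.inl v) (.inr v)
  have h₁₂ : K.toBlocks₁₂ = diagonal φ := by
    ext i j
    by_cases hij : i = j
    · subst hij; simp [φ, toBlocks₁₂]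
    · rw [diagonal_apply_ne _ hij]
      exact hK (.inl i) (.inr j) hij
  have h₂₁ : K.toBlocks₂₁ = 0 := by
    ext i j
    exact hK (.inr i) (.inl j) id
  have u₁ : (1 - Λ₁).det ≠ 0 := s₁.det_one_sub_ne_zero G.wellFounded_adj
  have u₂ : (1 - Λ₂).det ≠ 0 := s₂.det_one_sub_ne_zero G.wellFounded_adj
  have hK' : 1 - K = fromBlocks (1 - Λ₁)ᵀ (-diagonal φ) 0 (1 - Λ₂) := by
    rw [← fromBlocks_toBlocks K, ← fromBlocks_one, sub_eq_add_neg, fromBlocks_neg, fromBlocks_add, h₁₂,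
      h₂₁, neg_zero, add_zero, zero_add, ← sub_eq_add_neg, ← sub_eq_add_neg, transpose_sub,
      transpose_one, hΛ₁, transpose_transpose]
  -- The off-diagonal block of the path matrix of the doubled graph is `N₁ᵀ Φ N₂`.
  have hinv : (1 - K)⁻¹ = fromBlocks ((1 - Λ₁)ᵀ)⁻¹ ((1 - Λ₁)⁻¹ᵀ * diagonal φ * (1 - Λ₂)⁻¹) 0
      (1 - Λ₂)⁻¹ := by
    rw [hK', inv_fromBlocks_zero₂₁_of_isUnit_iff]
    · simp only [transpose_nonsing_inv, Matrix.mul_neg, Matrix.neg_mul, neg_neg]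
    · rw [isUnit_iff_isUnit_det, isUnit_iff_isUnit_det, det_transpose]
      simp [u₁, u₂]
  have hfact : (1 - K)⁻¹.submatrix (fun i => (f' i : V ⊕ V)) (fun i => (g' i : V ⊕ V)) =
      (((1 - Λ₁)⁻¹.submatrix id (fun i => (f i : V)))ᵀ * diagonal φ) *
        (1 - Λ₂)⁻¹.submatrix id (fun i => (g i : V)) := by
    ext i j
    rw [submatrix_apply, hf, hg, hinv, fromBlocks_apply₁₂]
    simp [mul_apply]
  rw [hfact] at hdet
  obtain ⟨s, hs₁, hs₂⟩ := exists_common_minor _ _ hdet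
  have hs₁' : ((1 - Λ₁)⁻¹.submatrix s (fun i => (f i : V))).det ≠ 0 := by
    have : (((1 - Λ₁)⁻¹.submatrix id (fun i => (f i : V)))ᵀ * diagonal φ).submatrix id s =
        ((1 - Λ₁)⁻¹.submatrix s (fun i => (f i : V)))ᵀ * diagonal (φ ∘ s) := by
      ext i j
      simp
    rw [this, det_mul, det_transpose] at hs₁
    exact left_ne_zero_of_mul hs₁
  obtain ⟨Λ, hΛ, h1, h2⟩ := s₁.exists_common G.wellFounded_adj s₂ hs₁' hs₂
  exact ⟨Λ, s, f, g, hΛ, h1, h2⟩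

/-- Splitting the paths by their last vertex in `CA` or `CB` factors the submatrix through
`CA ⊕ CB`. -/
theorem subRank_le_of_tSeparates {G : DAG V} {CA CB A B : Finset V}
    (h : G.TSeparates CA CB A B) {Λ : Matrix V V ℝ} (hΛ : SupportedOn G.Adj Λ) (φ : V → ℝ) :
    subRank ((1 - Λ)⁻¹ᵀ * diagonal φ * (1 - Λ)⁻¹) A B ≤ CA.card + CB.card := by
  obtain ⟨w₁, m₁, hN₁, hw₁⟩ := hΛ.exists_factor G.wellFounded_adj CA
  obtain ⟨w₂, m₂, hN₂, hw₂⟩ := hΛ.exists_factor G.wellFounded_adj CB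
  set N := (1 - Λ)⁻¹
  have hS (a b : V) : (Nᵀ * diagonal φ * N) a b = ∑ k, N k a * φ k * N k b := by
    rw [mul_apply]
    simp [mul_diagonal]
  let P : Matrix A (CA ⊕ CB) ℝ := of fun a c =>
    Sum.elim (fun c : CA => m₁ c a) (fun c : CB => ∑ k, w₁ k a * φ k * N k c) c
  let Q : Matrix (CA ⊕ CB) B ℝ := of fun c b =>
    Sum.elim (fun c : CA => ∑ k, N k c * φ k * N k b) (fun c : CB => m₂ c b) c
  have hPQ : (Nᵀ * diagonal φ * N).submatrix (fun a : A => (a : V)) (fun b : B => (b : V)) =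
      P * Q := by
    ext a b
    -- a trek with top `k` that avoids the pair would contradict `t`-separation
    have h0 (k : V) : w₁ k a * φ k * w₂ k b = 0 := by
      by_contra hne
      exact tSeparates_iff.1 h a a.2 b b.2 k
        ⟨hw₁ k a fun h => hne (by simp [h]), hw₂ k b fun h => hne (by simp [h])⟩
    have h1 (k : V) : N k a * φ k * N k b =
        (∑ c ∈ CA, m₁ c a * (N k c * φ k * N k b)) +
          ∑ c ∈ CB, w₁ k a * φ k * N k c * m₂ c b := by
      have h2 : w₁ k a * φ k * N k b = ∑ c ∈ CB, w₁ k a * φ k * N k c * m₂ c b := by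
        rw [hN₂ k b, mul_add, h0, zero_add, Finset.mul_sum]
        exact Finset.sum_congr rfl fun c _ => by ring
      rw [hN₁ k a, ← h2, add_mul, add_mul, Finset.sum_mul, Finset.sum_mul, add_comm]
      congr 1
      exact Finset.sum_congr rfl fun c _ => by ring
    rw [submatrix_apply, hS, mul_apply, Fintype.sum_sum_type, Finset.sum_congr rfl fun k _ => h1 k,
      Finset.sum_add_distrib]
    congr 1
    · rw [Finset.sum_comm, ← Finset.sum_coe_sort CA]
      exact Finset.sum_congr rfl fun c _ => by simp [P, Q, Finset.mul_sum]
    · rw [Finset.sum_comm, ← Finset.sum_coe_sort CB]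
      exact Finset.sum_congr rfl fun c _ => by simp [P, Q, Finset.sum_mul]
  rw [subRank, hPQ]
  exact (rank_mul_le_left P Q).trans (P.rank_le_card_width.trans_eq (by simp))

/-! ### The minors as polynomials in the parameters -/

/-- The edge matrix with an indeterminate for each edge. -/
noncomputable def polyEdgeMatrix (G : DAG V) : Matrix V V (MvPolynomial (G.Edge ⊕ V) ℝ) :=
  G.edgeMatrix fun e => MvPolynomial.X (.inl e)

/-- The matrix of polynomials `adj(1 - Λ)ᵀ Φ adj(1 - Λ)` in the indeterminates `λ` and `φ`. Since the
adjugate is a nonzero multiple of the inverse, its values have the same minors as the covariance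
matrix, up to nonzero factors. -/
noncomputable def polyCov (G : DAG V) : Matrix V V (MvPolynomial (G.Edge ⊕ V) ℝ) :=
  (1 - G.polyEdgeMatrix).adjugateᵀ *
    diagonal (fun v => MvPolynomial.X (.inr v)) *
    (1 - G.polyEdgeMatrix).adjugate

theorem eval_det_polyCov_ne_zero_iff (G : DAG V) (z : G.Edge ⊕ V → ℝ) {k : ℕ} (f g : Fin k → V) :
    MvPolynomial.eval z (G.polyCov.submatrix f g).det ≠ 0 ↔
      (((1 - G.edgeMatrix (z ∘ .inl))⁻¹ᵀ * diagonal (z ∘ .inr) *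
        (1 - G.edgeMatrix (z ∘ .inl))⁻¹).submatrix f g).det ≠ 0 := by
  set M := 1 - G.edgeMatrix (z ∘ .inl)
  have hdet : M.det ≠ 0 := (G.supportedOn_edgeMatrix _).det_one_sub_ne_zero G.wellFounded_adj
  have h1 : (MvPolynomial.eval z).mapMatrix
      (1 - G.polyEdgeMatrix) = M := by
    rw [map_sub, map_one]
    congr 1
    ext i j
    by_cases h : G.Adj i j <;> simp [polyEdgeMatrix, edgeMatrix, h]
  have h2 : (MvPolynomial.eval z).mapMatrix G.polyCov =
      M.adjugateᵀ * diagonal (z ∘ .inr) * M.adjugate := by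
    have h3 : (MvPolynomial.eval z).mapMatrix
        (1 - G.polyEdgeMatrix).adjugate = M.adjugate := by
      rw [RingHom.map_adjugate, h1]
    rw [polyCov, map_mul, map_mul, h3]
    congr 2
    · rw [← h3]; rfl
    · ext i j
      by_cases h : i = j
      · subst h; simp
      · simp [h]
  have h4 : M.adjugate = M.det • M⁻¹ := by
    rw [inv_def, Ring.inverse_eq_inv', smul_smul, mul_inv_cancel₀ hdet, one_smul]
  have h5 : MvPolynomial.eval z (G.polyCov.submatrix f g).det =
      (M.det * M.det) ^ k * ((M⁻¹ᵀ * diagonal (z ∘ .inr) * M⁻¹).submatrix f g).det := by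
    have : (MvPolynomial.eval z).mapMatrix (G.polyCov.submatrix f g) =
        (M.det * M.det) • (M⁻¹ᵀ * diagonal (z ∘ .inr) * M⁻¹).submatrix f g := by
      change ((MvPolynomial.eval z).mapMatrix G.polyCov).submatrix f g = _
      rw [h2, h4, transpose_smul, Matrix.smul_mul, Matrix.smul_mul, Matrix.mul_smul, smul_smul]
      rfl
    rw [RingHom.map_det, this, det_smul, Fintype.card_fin]
  rw [h5]
  simp [hdet]

/-- The sum of the squares of the `k × k` minors with rows in `A` and columns in `B`, repeated
rows or columns allowed. -/
noncomputable def minorPoly (G : DAG V) (A B : Finset V) (k : ℕ) :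
    MvPolynomial (G.Edge ⊕ V) ℝ :=
  ∑ f : Fin k → A, ∑ g : Fin k → B,
    (G.polyCov.submatrix (fun i => (f i : V)) (fun i => (g i : V))).det ^ 2

theorem eval_minorPoly_ne_zero_iff (G : DAG V) (A B : Finset V) (k : ℕ) (z : G.Edge ⊕ V → ℝ) :
    MvPolynomial.eval z (G.minorPoly A B k) ≠ 0 ↔
      k ≤ subRank ((1 - G.edgeMatrix (z ∘ .inl))⁻¹ᵀ * diagonal (z ∘ .inr) *
        (1 - G.edgeMatrix (z ∘ .inl))⁻¹) A B := by
  simp only [le_subRank_iff, ← eval_det_polyCov_ne_zero_iff, minorPoly, map_sum, map_pow]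
  rw [← not_iff_not]
  push Not
  rw [Finset.sum_eq_zero_iff_of_nonneg fun _ _ => Finset.sum_nonneg fun _ _ => sq_nonneg _]
  simp [Finset.sum_eq_zero_iff_of_nonneg, sq_nonneg]

theorem le_subRank_covMatrix_iff (G : DAG V) (A B : Finset V) (k : ℕ) (θ : G.Param) :
    k ≤ subRank (G.covMatrix θ) A B ↔ MvPolynomial.eval θ.coords (G.minorPoly A B k) ≠ 0 := by
  rw [eval_minorPoly_ne_zero_iff, covMatrix_eq]
  rfl

/-- At the error variances that are one at the trek tops and zero elsewhere, a minor of the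
covariance matrix is the product of two minors of the path matrix. -/
theorem minorPoly_ne_zero {G : DAG V} {A B : Finset V} {k : ℕ}
    (h : ∀ CA CB, G.TSeparates CA CB A B → k ≤ CA.card + CB.card) : G.minorPoly A B k ≠ 0 := by
  obtain ⟨Λ, s, f, g, hΛ, hf, hg⟩ := exists_weights h
  have hs : Function.Injective s := by
    intro i j hij
    by_contra hne
    exact hf (det_zero_of_row_eq hne (by ext l; simp [hij]))
  let z : G.Edge ⊕ V → ℝ := Sum.elim (fun e => Λ e.1.1 e.1.2)
    (fun v => if v ∈ Set.range s then 1 else 0)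
  have hz : G.edgeMatrix (z ∘ .inl) = Λ := by
    ext i j
    by_cases hij : G.Adj i j
    · simp [edgeMatrix, z, hij]
    · simp [edgeMatrix, hij, hΛ i j hij]
  intro h0
  refine (G.eval_minorPoly_ne_zero_iff A B k z).2 ?_ (by rw [h0, map_zero])
  refine le_subRank_iff.2 ⟨f, g, ?_⟩
  rw [hz]
  set N := (1 - Λ)⁻¹
  have hfact : (Nᵀ * diagonal (z ∘ .inr) * N).submatrix (fun i => (f i : V)) (fun i => (g i : V)) =
      (N.submatrix s (fun i => (f i : V)))ᵀ * N.submatrix s (fun i => (g i : V)) := by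
    ext i j
    rw [submatrix_apply, mul_apply, mul_apply]
    simp only [mul_diagonal, transpose_apply, submatrix_apply]
    rw [← Finset.sum_image (s := Finset.univ) (g := s) (f := fun v => N v (f i) * N v (g j))
      fun _ _ _ _ h => hs h]
    symm
    refine Finset.sum_subset_zero_on_sdiff (Finset.subset_univ _) (fun v hv => ?_) fun v hv => ?_
    · have : ¬ ∃ y, s y = v := by simpa using hv
      simp [z, this]
    · have : ∃ y, s y = v := by simpa using hv
      simp [z, this]
  rw [hfact, det_mul, det_transpose]
  exact mul_ne_zero hf hg

end DAG

end

theorem theorem2p8 {V : Type*} [Fintype V] (G : DAG V) (A B : Finset V) :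
    (∀ r : ℕ, (∀ M ∈ G.gaussianModel, subRank M A B ≤ r) ↔
      ∃ CA CB : Finset V, CA.card + CB.card ≤ r ∧ G.TSeparates CA CB A B) ∧
    ∃ t : ℕ, IsLeast (G.tSepSizes A B) t ∧
      (∀ M ∈ G.gaussianModel, subRank M A B ≤ t) ∧
      G.IsGeneric (fun θ => subRank (G.covMatrix θ) A B = t) ∧
      (∃ p : MvPolynomial (G.Edge ⊕ V) ℝ, p ≠ 0 ∧
        ∀ θ : G.Param, subRank (G.covMatrix θ) A B < t ↔ MvPolynomial.eval θ.coords p = 0) := by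
  classical
  have hne : (G.tSepSizes A B).Nonempty :=
    ⟨_, A, ∅, fun a ha _ _ T => .inl ⟨a, List.mem_of_getLast? T.isPath₁.sink, ha⟩, rfl⟩
  have hleast : IsLeast (G.tSepSizes A B) (sInf (G.tSepSizes A B)) :=
    ⟨Nat.sInf_mem hne, fun _ h => Nat.sInf_le h⟩
  set t := sInf (G.tSepSizes A B)
  have hupper (CA CB : Finset V) (h : G.TSeparates CA CB A B) :
      ∀ M ∈ G.gaussianModel, subRank M A B ≤ CA.card + CB.card := by
    rintro _ ⟨θ, rfl⟩
    rw [G.covMatrix_eq]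
    exact DAG.subRank_le_of_tSeparates h (G.supportedOn_edgeMatrix _) _
  obtain ⟨CA, CB, hsep, hcard⟩ := hleast.1
  have hle : ∀ M ∈ G.gaussianModel, subRank M A B ≤ t := hcard ▸ hupper CA CB hsep
  have hp : G.minorPoly A B t ≠ 0 :=
    DAG.minorPoly_ne_zero fun CA CB h => hleast.2 ⟨CA, CB, h, rfl⟩
  have hdense := G.dense_eval_coords_ne_zero hp
  refine ⟨fun r => ⟨fun hr => ?_, ?_⟩, t, hleast, hle,
    ⟨_, G.isOpen_eval_coords_ne_zero _, hdense, fun θ hθ =>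
      (hle _ ⟨θ, rfl⟩).antisymm ((G.le_subRank_covMatrix_iff A B t θ).2 hθ)⟩,
    _, hp, fun θ => ?_⟩
  · have : Nonempty G.Param := ⟨(0, fun _ => ⟨1, one_pos (α := ℝ)⟩)⟩
    obtain ⟨θ, hθ⟩ := hdense.nonempty
    exact ⟨CA, CB, hcard.trans_le (((G.le_subRank_covMatrix_iff A B t θ).2 hθ).trans
      (hr _ ⟨θ, rfl⟩)), hsep⟩
  · rintro ⟨CA, CB, hr, h⟩ M hM
    exact (hupper CA CB h M hM).trans hr
  · rw [← not_le, G.le_subRank_covMatrix_iff, not_not]
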